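/- Play Lights Out on the $n\times n$ grid graph $G_n=(V,E)$: each vertex carries a light that is on or off, and clicking a vertex toggles its own light and those of its neighbors. Let $\Phi_{G_n}:\mathbb{F}_2^V\to\mathbb{F}_2^V$ be the linear map sending (the indicator of) a set of clicked vertices to (the indicator of) the set of lights that change state, and let $d(n)=\dim_{\mathbb{F}_2}\ker\Phi_{G_n}$ be the nullity of the grid. A solution of an initial configuration is a finite sequence of clicks that turns off all the lights. The answer to the Most Clicks Problem on $G_n$ is the maximum, over all solvable initial configurations, of the minimum number of clicks in a solution. If $d(n)=2$, then $n\equiv -1 \pmod 6$. Moreover, in this case, writing $n=6k-1$ with $k\in\mathbb{N}$, the answer to the Most Clicks Problem on the $n\times n$ grid is exactly $26k^2-12k+1$. -/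

import Mathlib

open scoped BigOperators

noncomputable section

namespace LightsOut

/-- The `n × n` grid graph: vertices `(i, j)` with `0 ≤ i, j < n`, two of them being adjacent
when they agree in one coordinate and differ by exactly one in the other. -/
def grid (n : ℕ) : SimpleGraph (Fin n × Fin n) :=
  (SimpleGraph.pathGraph n).boxProd (SimpleGraph.pathGraph n)

/-- The lights that change state when `v` is clicked: `v` and its neighbours. A set of vertices
is encoded by its indicator with values in `ZMod 2`, so that `+` is symmetric difference; in a
configuration of lights the value `1` means on and `0` means off. -/
def toggle {V : Type*} (G : SimpleGraph V) (v : V) : V → ZMod 2 :=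
  open Classical in fun w => if w = v ∨ G.Adj v w then 1 else 0

/-- The linear map `Φ_G`, sending a set of clicked vertices to the set of lights that change
state: `x ↦ ∑ v, x v • toggle G v`. -/
def Phi {V : Type*} [Fintype V] (G : SimpleGraph V) :
    (V → ZMod 2) →ₗ[ZMod 2] (V → ZMod 2) :=
  Fintype.linearCombination (ZMod 2) (toggle G)

/-- The nullity of `G`, `dim ker Φ_G` over the field with two elements. -/
def nullity {V : Type*} [Fintype V] (G : SimpleGraph V) : ℕ :=
  Module.finrank (ZMod 2) (LinearMap.ker (Phi G))

/-- The nullity `d(n)` of the `n × n` grid. -/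
def d (n : ℕ) : ℕ := nullity (grid n)

/-- The configuration after clicking `v` in configuration `c`. -/
def click {V : Type*} (G : SimpleGraph V) (c : V → ZMod 2) (v : V) : V → ZMod 2 :=
  c + toggle G v

/-- A solution of the configuration `c`: a sequence of clicks that turns off all the lights. -/
def IsSolution {V : Type*} (G : SimpleGraph V) (c : V → ZMod 2) (l : List V) : Prop :=
  l.foldl (click G) c = 0

/-- The configuration `c` is solvable, and the fewest clicks in a solution of it is `m`. -/
def RequiresClicks {V : Type*} (G : SimpleGraph V) (c : V → ZMod 2) (m : ℕ) : Prop :=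
  IsLeast {k : ℕ | ∃ l : List V, IsSolution G c l ∧ l.length = k} m

/-- `m` is the answer to the Most Clicks Problem on `G`: the largest number of clicks that some
solvable initial configuration requires. -/
def IsMostClicks {V : Type*} (G : SimpleGraph V) (m : ℕ) : Prop :=
  IsGreatest {k : ℕ | ∃ c : V → ZMod 2, RequiresClicks G c k} m

end LightsOut

end

namespace LightsOut

open Finset

/-! With $A$ the path matrix, the kernel $K$ consists of the matrices $X$ with $X+AX+XA=0$; it is
stable under $X\mapsto AX$ and under transposition. Suppose $\dim K=2$. Some nonzero element of $K$
is killed by $A$, or is fixed by $A$, or else $A^2+A+1$ annihilates $K$. If $AX=0$, then $XA=X$: the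
columns of $X$ force $2\mid n+1$ and its rows force $3\mid n+1$. The fixed case is the transpose of
this one. In the last case $5\mid n+1$, but then reflecting a $4\times4$ solution gives an element
of $K$ not annihilated by $A^2+A+1$ (`exists_inKernel_not_quadratic`), a contradiction.

For $n=6k-1$, $K$ is spanned by a product of stripes of periods 2 and 3 and its transpose. Only
parities of clicks matter, so the answer is the covering radius of $K$ as a binary code. Averaging
the four weights in a coset bounds it above (`sum_weights_le`), and evenness of the three nonzero
classes makes the bound sharp (`exists_forall_weight_eq`). -/

/-! ### The grid operator in terms of matrices -/

/-- The adjacency matrix of the path on `n` vertices, over the field with two elements. -/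
def pathMatrix (n : ℕ) : Matrix (Fin n) (Fin n) (ZMod 2) :=
  Matrix.of fun i j => if i.val + 1 = j.val ∨ j.val + 1 = i.val then 1 else 0

theorem pathMatrix_apply {n : ℕ} (i j : Fin n) :
    pathMatrix n i j = if i.val + 1 = j.val ∨ j.val + 1 = i.val then 1 else 0 := rfl

theorem pathMatrix_transpose (n : ℕ) : (pathMatrix n).transpose = pathMatrix n := by
  ext i j
  simp only [Matrix.transpose_apply, pathMatrix_apply, or_comm]

theorem toggle_grid_apply {n : ℕ} (v w : Fin n × Fin n) :
    toggle (grid n) v w = (if v.1 = w.1 then 1 else 0) * (if v.2 = w.2 then 1 else 0) +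
      pathMatrix n w.1 v.1 * (if v.2 = w.2 then 1 else 0) +
      (if v.1 = w.1 then 1 else 0) * pathMatrix n v.2 w.2 := by
  obtain ⟨a, b⟩ := v
  obtain ⟨c, e⟩ := w
  simp only [toggle, grid, SimpleGraph.boxProd_adj, SimpleGraph.pathGraph_adj, pathMatrix_apply,
    Prod.mk.injEq, Fin.ext_iff]
  by_cases h1 : a.val = c.val <;> by_cases h2 : b.val = e.val
  · simp [h1, h2]
  · simp [h1, h2, Ne.symm h2]
  · simp [h1, h2, Ne.symm h1, or_comm]
  · simp [h1, h2, Ne.symm h1]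

theorem Phi_apply {V : Type*} [Fintype V] (G : SimpleGraph V) (x : V → ZMod 2) (w : V) :
    Phi G x w = ∑ v, x v * toggle G v w := by
  simp [Phi, Fintype.linearCombination_apply]

theorem Phi_grid_uncurry {n : ℕ} (X : Matrix (Fin n) (Fin n) (ZMod 2)) (i j : Fin n) :
    Phi (grid n) (fun v => X v.1 v.2) (i, j) =
      (X + pathMatrix n * X + X * pathMatrix n) i j := by
  rw [Phi_apply, Fintype.sum_prod_type]
  simp only [toggle_grid_apply, mul_add, sum_add_distrib, Matrix.add_apply, Matrix.mul_apply]
  congr 1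
  · congr 1
    · simp
    · simp [mul_comm]
  · rw [sum_comm]
    simp

/-- The kernel of the grid operator, as a condition on matrices. -/
def InKernel {n : ℕ} (X : Matrix (Fin n) (Fin n) (ZMod 2)) : Prop :=
  X + pathMatrix n * X + X * pathMatrix n = 0

theorem mem_ker_iff_inKernel {n : ℕ} (X : Matrix (Fin n) (Fin n) (ZMod 2)) :
    (fun v : Fin n × Fin n => X v.1 v.2) ∈ LinearMap.ker (Phi (grid n)) ↔ InKernel X := by
  rw [LinearMap.mem_ker, InKernel]
  constructor
  · intro h
    ext i j
    rw [← Phi_grid_uncurry, h]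
    rfl
  · intro h
    ext ⟨i, j⟩
    rw [Phi_grid_uncurry, h]
    rfl

namespace InKernel

variable {n : ℕ} {X Y : Matrix (Fin n) (Fin n) (ZMod 2)}

theorem add (hX : InKernel X) (hY : InKernel Y) : InKernel (X + Y) := by
  unfold InKernel at *
  rw [mul_add, add_mul, ← add_zero (0 : Matrix (Fin n) (Fin n) (ZMod 2))]
  nth_rewrite 1 [← hX]
  rw [← hY]
  abel

/-- Left multiplication by the path matrix commutes with $X\mapsto X+AX+XA$. This turns the kernel
into a module over polynomials in $A$. -/
theorem pathMatrix_mul (hX : InKernel X) : InKernel (pathMatrix n * X) := by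
  have h := congrArg (pathMatrix n * ·) hX
  simpa only [InKernel, mul_add, mul_zero, mul_assoc] using h

theorem transpose (hX : InKernel X) : InKernel X.transpose := by
  have h := congrArg Matrix.transpose hX
  simp only [Matrix.transpose_add, Matrix.transpose_mul, pathMatrix_transpose,
    Matrix.transpose_zero] at h
  rw [InKernel, ← h]
  abel

end InKernel

/-! ### Planes over the field with two elements -/

theorem add_self_eq_zero_of_zmod_two {M : Type*} [AddCommGroup M] [Module (ZMod 2) M] (x : M) :
    x + x = 0 := by
  rw [← two_smul (ZMod 2) x, show (2 : ZMod 2) = 0 from rfl, zero_smul]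

theorem eq_of_add_eq_zero_of_zmod_two {M : Type*} [AddCommGroup M] [Module (ZMod 2) M] {x y : M}
    (h : x + y = 0) : x = y :=
  add_right_cancel (h.trans (add_self_eq_zero_of_zmod_two y).symm)

theorem mem_plane_cases {M : Type*} [AddCommGroup M] [Module (ZMod 2) M] [Finite M]
    {W : Submodule (ZMod 2) M} (hW : Module.finrank (ZMod 2) W = 2) {a b : M} (ha : a ∈ W)
    (hb : b ∈ W) (ha0 : a ≠ 0) (hb0 : b ≠ 0) (hab : a ≠ b) {w : M} (hw : w ∈ W) :
    w = 0 ∨ w = a ∨ w = b ∨ w = a + b := by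
  classical
  have := Fintype.ofFinite W
  have hcard : Fintype.card W = 4 := by
    rw [Module.card_eq_pow_finrank (K := ZMod 2) (V := W), hW, ZMod.card]
    rfl
  have hab0 : a + b ≠ 0 := fun h => hab (eq_of_add_eq_zero_of_zmod_two h)
  let S : Finset W := {0, ⟨a, ha⟩, ⟨b, hb⟩, ⟨a + b, W.add_mem ha hb⟩}
  have hS : S.card = 4 := by
    simp only [S]
    rw [card_insert_of_notMem, card_insert_of_notMem, card_insert_of_notMem, card_singleton]
    · simpa [Subtype.ext_iff] using ha0
    · simpa [Subtype.ext_iff] using ⟨hab, hb0⟩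
    · simp only [mem_insert, mem_singleton, Subtype.ext_iff, ZeroMemClass.coe_zero, not_or]
      exact ⟨ha0.symm, hb0.symm, hab0.symm⟩
  have hu : S = univ := eq_univ_of_card S (hS.trans hcard.symm)
  have := hu ▸ mem_univ (⟨w, hw⟩ : W)
  simpa [S, Subtype.ext_iff] using this

theorem InKernel.cases {n : ℕ} (hn : d n = 2) {X Y Z : Matrix (Fin n) (Fin n) (ZMod 2)}
    (hX : InKernel X) (hY : InKernel Y) (hX0 : X ≠ 0) (hY0 : Y ≠ 0) (hXY : X ≠ Y)
    (hZ : InKernel Z) : Z = 0 ∨ Z = X ∨ Z = Y ∨ Z = X + Y := by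
  have inj : ∀ {P Q : Matrix (Fin n) (Fin n) (ZMod 2)},
      (fun v : Fin n × Fin n => P v.1 v.2) = (fun v => Q v.1 v.2) → P = Q := fun h => by
    ext i j
    exact congrFun h (i, j)
  have key := mem_plane_cases hn ((mem_ker_iff_inKernel X).2 hX) ((mem_ker_iff_inKernel Y).2 hY)
    (fun h => hX0 (inj h)) (fun h => hY0 (inj h)) (fun h => hXY (inj h))
    ((mem_ker_iff_inKernel Z).2 hZ)
  rcases key with h | h | h | h
  · exact Or.inl (inj h)
  · exact Or.inr (Or.inl (inj h))
  · exact Or.inr (Or.inr (Or.inl (inj h)))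
  · exact Or.inr (Or.inr (Or.inr (inj h)))

/-! ### The path matrix acts by a two-sided shift -/

theorem pathMatrix_sum {n : ℕ} (Y : ℕ → ZMod 2) (h0 : Y 0 = 0) (hn : Y (n + 1) = 0) (i : Fin n) :
    ∑ j : Fin n, pathMatrix n i j * Y (j + 1) = Y i + Y (i + 2) := by
  obtain ⟨i, hi⟩ := i
  simp only [pathMatrix_apply]
  rw [Fin.sum_univ_eq_sum_range
    (fun j => (if i + 1 = j ∨ j + 1 = i then (1 : ZMod 2) else 0) * Y (j + 1)) n]
  have h : ∀ j, (if i + 1 = j ∨ j + 1 = i then (1 : ZMod 2) else 0) * Y (j + 1) =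
      (if j + 1 = i then Y i else 0) + (if i + 1 = j then Y (i + 2) else 0) := by
    intro j
    by_cases h1 : j + 1 = i
    · subst h1
      simp only [or_true, if_true, one_mul, left_eq_add, ite_eq_right_iff]
      omega
    · by_cases h2 : i + 1 = j
      · subst h2
        simp [h1]
      · simp [h1, h2]
  simp only [h, sum_add_distrib]
  congr 1
  · rcases i with _ | i
    · simp [h0]
    · simp only [add_left_inj, sum_ite_eq', mem_range]
      rw [if_pos (by omega)]
  · rw [sum_ite_eq]
    split_ifs with h'
    · rfl
    · rw [mem_range] at h'
      rw [show i + 2 = n + 1 by omega, hn]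

/-- Extension by zero of a vector indexed by `Fin n`, moved to the positions `1, …, n`. -/
def extend {n : ℕ} (y : Fin n → ZMod 2) (i : ℕ) : ZMod 2 :=
  if h : 1 ≤ i ∧ i ≤ n then y ⟨i - 1, by omega⟩ else 0

theorem extend_succ {n : ℕ} (y : Fin n → ZMod 2) (i : Fin n) : extend y (i + 1) = y i := by
  simp [extend]

theorem extend_zero {n : ℕ} (y : Fin n → ZMod 2) : extend y 0 = 0 := by
  simp [extend]

theorem extend_last {n : ℕ} (y : Fin n → ZMod 2) : extend y (n + 1) = 0 := by
  simp [extend]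

/-- This solves the row equation for the later neighbour, so a polynomial relation for $A$ on $X$
becomes a linear recurrence down each column, with zeros at positions $0$ and $n+1$. -/
theorem extend_step {n : ℕ} (X : Matrix (Fin n) (Fin n) (ZMod 2)) (j : Fin n) (i : ℕ)
    (hi : i + 2 ≤ n + 1) :
    extend (fun r => X r j) (i + 2) =
      extend (fun r => (pathMatrix n * X) r j) (i + 1) + extend (fun r => X r j) i := by
  have h := pathMatrix_sum (extend fun r => X r j) (extend_zero _) (extend_last _)
    ⟨i, by omega⟩
  have h' := extend_succ (fun r => (pathMatrix n * X) r j) ⟨i, by omega⟩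
  simp only [extend_succ] at h
  simp only [Matrix.mul_apply] at h' ⊢
  rw [h', h, add_comm (extend _ i), add_assoc, add_self_eq_zero_of_zmod_two, add_zero]

/-! ### Recurrences over the field with two elements -/

theorem two_dvd_of_recurrence (N : ℕ) : ∀ y : ℕ → ZMod 2, y 0 = 0 → y 1 ≠ 0 → y N = 0 →
    (∀ i, i + 2 ≤ N → y (i + 2) = y i) → 2 ∣ N := by
  induction N using Nat.strong_induction_on with
  | _ N ih =>
    intro y h0 h1 hN hr
    rcases Nat.lt_or_ge N 2 with h | h
    · interval_cases N
      · simp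
      · exact absurd hN h1
    · obtain ⟨M, rfl⟩ := Nat.exists_eq_add_of_le' h
      rcases M with _ | M
      · simp
      have := ih (M + 1) (by omega) (fun i => y (i + 2)) ((hr 0 (by omega)).trans h0)
        (by rw [show y (1 + 2) = y 1 from hr 1 (by omega)]; exact h1) hN
        (fun i hi => hr (i + 2) (by omega))
      omega

/-- The sequence is $0,1,1$ repeated, the Fibonacci numbers mod 2; the induction removes one period.
-/
theorem three_dvd_of_recurrence (N : ℕ) : ∀ y : ℕ → ZMod 2, y 0 = 0 → y 1 ≠ 0 → y N = 0 →
    (∀ i, i + 2 ≤ N → y (i + 2) = y (i + 1) + y i) → 3 ∣ N := by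
  induction N using Nat.strong_induction_on with
  | _ N ih =>
    intro y h0 h1 hN hr
    rcases Nat.lt_or_ge N 3 with h | h
    · interval_cases N
      · simp
      · exact absurd hN h1
      · rw [show y 2 = y 1 + y 0 from hr 0 le_rfl, h0, add_zero] at hN
        exact absurd hN h1
    · obtain ⟨M, rfl⟩ := Nat.exists_eq_add_of_le' h
      have r2 : y 2 = y 1 + y 0 := hr 0 (by omega)
      have r3 : y 3 = y 2 + y 1 := hr 1 (by omega)
      have e3 : y 3 = 0 := by rw [r3, r2, h0, add_zero, add_self_eq_zero_of_zmod_two]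
      rcases M with _ | M
      · simp
      have r4 : y 4 = y 3 + y 2 := hr 2 (by omega)
      have := ih (M + 1) (by omega) (fun i => y (i + 3)) (by simpa using e3)
        (by simpa [r4, e3, r2, h0] using h1) hN (fun i hi => hr (i + 3) (by omega))
      omega

/-- Identify pairs $(y,z)$ with $\mathbb F_4$, where $\omega(a,b)=(b,a+b)$ and $\omega^2=\omega+1$.
The recurrence is $s_{i+2}=\omega s_{i+1}+s_i$, giving $0,c,\omega c,\omega c,c,0,c,\dots$ with
zeros exactly at multiples of 5. -/
theorem five_dvd_of_recurrence (N : ℕ) : ∀ y z : ℕ → ZMod 2, y 0 = 0 → z 0 = 0 →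
    ¬ (y 1 = 0 ∧ z 1 = 0) → y N = 0 → z N = 0 → (∀ i, i + 2 ≤ N → y (i + 2) = z (i + 1) + y i) →
    (∀ i, i + 2 ≤ N → z (i + 2) = y (i + 1) + z (i + 1) + z i) → 5 ∣ N := by
  -- The expressions in these three tables are the terms of index 2 to 5, left unsimplified so as to
  -- match the rewritten recurrences.
  have table : ∀ a b : ZMod 2, ¬ (a = 0 ∧ b = 0) →
      ¬ (b = 0 ∧ a + b = 0) ∧ ¬ (a + b + a = 0 ∧ b + (a + b) + b = 0) := by decide
  have tab4 : ∀ a b : ZMod 2, ¬ (a = 0 ∧ b = 0) →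
      ¬ (b + (a + b) + b + b = 0 ∧ a + b + a + (b + (a + b) + b) + (a + b) = 0) := by decide
  have tab5 : ∀ a b : ZMod 2, a + b + a + (b + (a + b) + b) + (a + b) + (a + b + a) = 0 ∧
      b + (a + b) + b + b + (a + b + a + (b + (a + b) + b) + (a + b)) + (b + (a + b) + b) = 0 := by
    decide
  induction N using Nat.strong_induction_on with
  | _ N ih =>
    intro y z hy0 hz0 h1 hyN hzN hy hz
    have r2 : 2 ≤ N → y 2 = z 1 ∧ z 2 = y 1 + z 1 := fun h => by
      have e := hy 0 h
      have e' := hz 0 h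
      simp only [hy0, hz0, zero_add, add_zero] at e e'
      exact ⟨e, e'⟩
    have r3 : 3 ≤ N → y 3 = y 1 + z 1 + y 1 ∧ z 3 = z 1 + (y 1 + z 1) + z 1 := fun h => by
      obtain ⟨e, e'⟩ := r2 (by omega)
      exact ⟨by rw [← e']; exact hy 1 h, by rw [← e', ← e, hz 1 h, e]⟩
    have r4 : 4 ≤ N → y 4 = z 1 + (y 1 + z 1) + z 1 + z 1 ∧
        z 4 = y 1 + z 1 + y 1 + (z 1 + (y 1 + z 1) + z 1) + (y 1 + z 1) := fun h => by
      obtain ⟨e, e'⟩ := r2 (by omega)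
      obtain ⟨f, f'⟩ := r3 (by omega)
      exact ⟨by rw [hy 2 h, f', e], by rw [hz 2 h, f, f', e']⟩
    have r5 : 5 ≤ N → y 5 = 0 ∧ z 5 = 0 := fun h => by
      obtain ⟨f, f'⟩ := r3 (by omega)
      obtain ⟨g, g'⟩ := r4 (by omega)
      exact ⟨by rw [hy 3 h, g', f]; exact (tab5 _ _).1,
        by rw [hz 3 h, g, g', f']; exact (tab5 _ _).2⟩
    rcases Nat.lt_or_ge N 5 with h | h
    · interval_cases N
      · simp
      · exact absurd ⟨hyN, hzN⟩ h1
      · have := r2 le_rfl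
        rw [hyN, hzN] at this
        exact absurd ⟨this.1.symm, this.2.symm⟩ (table _ _ h1).1
      · have := r3 le_rfl
        rw [hyN, hzN] at this
        exact absurd ⟨this.1.symm, this.2.symm⟩ (table _ _ h1).2
      · have := r4 le_rfl
        rw [hyN, hzN] at this
        exact absurd ⟨this.1.symm, this.2.symm⟩ (tab4 _ _ h1)
    · obtain ⟨M, rfl⟩ := Nat.exists_eq_add_of_le' h
      obtain ⟨g, g'⟩ := r4 (by omega)
      obtain ⟨e5, e5'⟩ := r5 (by omega)
      rcases M with _ | M
      · simp
      have s6 : y 6 = y 4 := by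
        rw [show y 6 = z 5 + y 4 from hy 4 (by omega), e5', zero_add]
      have s6' : z 6 = z 4 := by
        rw [show z 6 = y 5 + z 5 + z 4 from hz 4 (by omega), e5, e5', zero_add, zero_add]
      have := ih (M + 1) (by omega) (fun i => y (i + 5)) (fun i => z (i + 5)) (by simpa using e5)
        (by simpa using e5')
        (by
          simp only [show 1 + 5 = 6 from rfl, s6, s6', g, g']
          exact tab4 _ _ h1)
        hyN hzN (fun i hi => hy (i + 5) (by omega)) (fun i hi => hz (i + 5) (by omega))
      omega

/-! ### Divisibility of $n+1$ from polynomial relations for the path matrix -/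

theorem exists_column_ne_zero {n : ℕ} {X : Matrix (Fin n) (Fin n) (ZMod 2)} (hX : X ≠ 0) :
    ∃ j, ∃ i ≤ n, extend (fun r => X r j) i ≠ 0 := by
  by_contra! h
  apply hX
  ext i j
  rw [← extend_succ (fun r => X r j) i]
  exact h j _ i.isLt

theorem eq_zero_of_second_order {y : ℕ → ZMod 2} {N : ℕ} (h0 : y 0 = 0) (h1 : y 1 = 0)
    (hr : ∀ i, i + 2 ≤ N → y i = 0 → y (i + 1) = 0 → y (i + 2) = 0) : ∀ i ≤ N, y i = 0 := by
  intro i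
  induction i using Nat.strong_induction_on with
  | _ i ih =>
    intro hi
    rcases i with _ | _ | i
    · exact h0
    · exact h1
    · exact hr i hi (ih _ (by omega) (by omega)) (ih _ (by omega) (by omega))

theorem two_dvd_of_pathMatrix_mul_eq_zero {n : ℕ} {X : Matrix (Fin n) (Fin n) (ZMod 2)}
    (hX : X ≠ 0) (h : pathMatrix n * X = 0) : 2 ∣ n + 1 := by
  obtain ⟨j, i, hi, hne⟩ := exists_column_ne_zero hX
  have hr : ∀ i, i + 2 ≤ n + 1 →
      extend (fun r => X r j) (i + 2) = extend (fun r => X r j) i := fun i hi => by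
    rw [extend_step X j i hi, h]
    simp [extend]
  refine two_dvd_of_recurrence (n + 1) _ (extend_zero _) (fun h1 => hne ?_) (extend_last _) hr
  exact eq_zero_of_second_order (N := n) (extend_zero _) h1
    (fun i hi e _ => by rw [hr i (by omega), e]) i hi

theorem three_dvd_of_pathMatrix_mul_eq_self {n : ℕ} {X : Matrix (Fin n) (Fin n) (ZMod 2)}
    (hX : X ≠ 0) (h : pathMatrix n * X = X) : 3 ∣ n + 1 := by
  obtain ⟨j, i, hi, hne⟩ := exists_column_ne_zero hX
  have hr : ∀ i, i + 2 ≤ n + 1 → extend (fun r => X r j) (i + 2) =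
      extend (fun r => X r j) (i + 1) + extend (fun r => X r j) i := fun i hi => by
    rw [extend_step X j i hi, h]
  refine three_dvd_of_recurrence (n + 1) _ (extend_zero _) (fun h1 => hne ?_) (extend_last _) hr
  exact eq_zero_of_second_order (N := n) (extend_zero _) h1
    (fun i hi e e' => by rw [hr i (by omega), e, e', add_zero]) i hi

theorem extend_add {n : ℕ} (x y : Fin n → ZMod 2) (i : ℕ) :
    extend (fun r => x r + y r) i = extend x i + extend y i := by
  unfold extend
  split_ifs <;> simp

theorem five_dvd_of_pathMatrix_quadratic {n : ℕ} {X : Matrix (Fin n) (Fin n) (ZMod 2)}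
    (hX : X ≠ 0) (h : pathMatrix n * (pathMatrix n * X) = X + pathMatrix n * X) : 5 ∣ n + 1 := by
  obtain ⟨j, i, hi, hne⟩ := exists_column_ne_zero hX
  have hy := extend_step X j
  have hz : ∀ i, i + 2 ≤ n + 1 → extend (fun r => (pathMatrix n * X) r j) (i + 2) =
      extend (fun r => X r j) (i + 1) + extend (fun r => (pathMatrix n * X) r j) (i + 1) +
        extend (fun r => (pathMatrix n * X) r j) i := fun i hi => by
    rw [extend_step (pathMatrix n * X) j i hi, h, ← extend_add]
    rfl
  refine five_dvd_of_recurrence (n + 1) _ _ (extend_zero _) (extend_zero _)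
    (fun h1 => hne ?_) (extend_last _) (extend_last _) hy hz
  have key : ∀ i ≤ n, extend (fun r => X r j) i = 0 ∧
      extend (fun r => (pathMatrix n * X) r j) i = 0 := by
    intro i
    induction i using Nat.strong_induction_on with
    | _ i ih =>
      intro hi
      rcases i with _ | _ | i
      · exact ⟨extend_zero _, extend_zero _⟩
      · exact h1
      · obtain ⟨e, e'⟩ := ih i (by omega) (by omega)
        obtain ⟨f, f'⟩ := ih (i + 1) (by omega) (by omega)
        rw [hy i (by omega), hz i (by omega), e, e', f, f']
        simp
  exact (key i hi).1

/-! ### Kernel elements given by explicit sequences -/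

theorem inKernel_of_sequence {n : ℕ} (F : ℕ → ℕ → ZMod 2) (h0 : ∀ j, F 0 j = 0)
    (h0' : ∀ i, F i 0 = 0) (hn : ∀ j, F (n + 1) j = 0) (hn' : ∀ i, F i (n + 1) = 0)
    (hF : ∀ i j, F (i + 1) (j + 1) + (F i (j + 1) + F (i + 2) (j + 1)) +
      (F (i + 1) j + F (i + 1) (j + 2)) = 0) :
    InKernel (Matrix.of fun i j : Fin n => F (i + 1) (j + 1)) := by
  ext i j
  simp only [Matrix.add_apply, Matrix.mul_apply, Matrix.of_apply, Matrix.zero_apply]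
  rw [pathMatrix_sum (fun i => F i (j + 1)) (h0 _) (hn _)]
  simp only [mul_comm (F _ _)]
  have := pathMatrix_sum (fun j => F (i + 1) j) (h0' _) (hn' _) j
  simp only [fun j' => show pathMatrix n j j' = pathMatrix n j' j from
    congrFun (congrFun (pathMatrix_transpose n).symm j) j'] at this
  rw [this]
  exact hF i j

/-- A doubly `10`-periodic pattern obtained by reflecting a solution on the `4 × 4` grid. -/
def tile : ZMod 10 → ZMod 10 → ZMod 2 :=
  !![0, 0, 0, 0, 0, 0, 0, 0, 0, 0;
     0, 1, 1, 1, 0, 0, 0, 1, 1, 1;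
     0, 0, 1, 0, 1, 0, 1, 0, 1, 0;
     0, 0, 0, 1, 1, 0, 1, 1, 0, 0;
     0, 0, 0, 0, 1, 0, 1, 0, 0, 0;
     0, 0, 0, 0, 0, 0, 0, 0, 0, 0;
     0, 0, 0, 0, 1, 0, 1, 0, 0, 0;
     0, 0, 0, 1, 1, 0, 1, 1, 0, 0;
     0, 0, 1, 0, 1, 0, 1, 0, 1, 0;
     0, 1, 1, 1, 0, 0, 0, 1, 1, 1]

theorem tile_sum : ∀ a b : ZMod 10, tile (a + 1) (b + 1) +
    (tile a (b + 1) + tile (a + 2) (b + 1)) + (tile (a + 1) b + tile (a + 1) (b + 2)) = 0 := by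
  decide

/-- The residues with $2a=0$ are $0$ and $5$, the mirror lines of the reflections; $n+1$ is one of
them when $5\mid n+1$. -/
theorem tile_left : ∀ a b : ZMod 10, 2 * a = 0 → tile a b = 0 := by decide

theorem tile_right : ∀ a b : ZMod 10, 2 * a = 0 → tile b a = 0 := by decide

theorem exists_inKernel_not_quadratic {n : ℕ} (hn : 5 ∣ n + 1) :
    ∃ X : Matrix (Fin n) (Fin n) (ZMod 2), InKernel X ∧
      pathMatrix n * (pathMatrix n * X) ≠ X + pathMatrix n * X := by
  have h4 : 4 ≤ n := by omega
  have hc : 2 * ((n + 1 : ℕ) : ZMod 10) = 0 := by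
    have : ((2 * (n + 1) : ℕ) : ZMod 10) = 0 := (ZMod.natCast_eq_zero_iff _ _).2 (by omega)
    exact_mod_cast this
  set X : Matrix (Fin n) (Fin n) (ZMod 2) :=
    Matrix.of fun i j : Fin n => tile ((i + 1 : ℕ) : ZMod 10) ((j + 1 : ℕ) : ZMod 10) with hX
  refine ⟨X, inKernel_of_sequence (fun i j => tile i j) (fun j => tile_left _ _ (by simp))
    (fun i => tile_right _ _ (by simp)) (fun j => tile_left _ _ hc) (fun i => tile_right _ _ hc)
    (fun i j => ?_), fun h => ?_⟩
  · push_cast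
    exact tile_sum i j
  · let c : Fin n := ⟨0, by omega⟩
    have e : ∀ i < n, extend (fun r => X r c) (i + 1) =
        tile ((i + 1 : ℕ) : ZMod 10) ((0 + 1 : ℕ) : ZMod 10) := fun i hi =>
      extend_succ (fun r => X r c) ⟨i, hi⟩
    have s : ∀ Y : Matrix (Fin n) (Fin n) (ZMod 2), ∀ i (hi : i + 2 ≤ n + 1),
        extend (fun r => (pathMatrix n * Y) r c) (i + 1) =
          extend (fun r => Y r c) (i + 2) + extend (fun r => Y r c) i := fun Y i hi => by
      rw [extend_step Y c i hi, add_assoc, add_self_eq_zero_of_zmod_two, add_zero]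
    -- The first column begins $1,0,0,0$. At its second position $A^2X$ is $0$ while $X+AX$ is $1$.
    have key := congrArg (fun Z : Matrix (Fin n) (Fin n) (ZMod 2) =>
      extend (fun r => Z r c) (1 + 1)) h
    simp only [Matrix.add_apply, extend_add] at key
    have e1 := e 0 (by omega)
    have e2 := e 1 (by omega)
    have e3 := e 2 (by omega)
    have e4 := e 3 (by omega)
    rw [s _ 1 (by omega), s _ 1 (by omega), s _ 2 (by omega), s _ 0 (by omega)] at key
    norm_num only at key e1 e2 e3 e4
    rw [e1, e2, e3, e4, extend_zero] at key
    revert key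
    decide

/-! ### The congruence modulo 6 -/

theorem six_dvd_of_d_eq_two {n : ℕ} (hn : d n = 2) : 6 ∣ n + 1 := by
  have base : ∀ X : Matrix (Fin n) (Fin n) (ZMod 2), InKernel X → X ≠ 0 →
      pathMatrix n * X = 0 → 6 ∣ n + 1 := fun X hX hX0 h => by
    have h2 := two_dvd_of_pathMatrix_mul_eq_zero hX0 h
    have ht : X.transpose ≠ 0 := fun h' => hX0 (by simpa using congrArg Matrix.transpose h')
    have h3 : 3 ∣ n + 1 := by
      refine three_dvd_of_pathMatrix_mul_eq_self ht ?_
      have e := hX.transpose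
      have e' := congrArg Matrix.transpose h
      rw [Matrix.transpose_mul, pathMatrix_transpose, Matrix.transpose_zero] at e'
      rw [InKernel, e', add_zero] at e
      exact (eq_of_add_eq_zero_of_zmod_two e).symm
    omega
  have fixed : ∀ X : Matrix (Fin n) (Fin n) (ZMod 2), InKernel X → X ≠ 0 →
      pathMatrix n * X = X → 6 ∣ n + 1 := fun X hX hX0 h => by
    refine base X.transpose hX.transpose
      (fun h' => hX0 (by simpa using congrArg Matrix.transpose h')) ?_
    have e := hX
    rw [InKernel, h, add_self_eq_zero_of_zmod_two, zero_add] at e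
    simpa [Matrix.transpose_mul, pathMatrix_transpose] using congrArg Matrix.transpose e
  obtain ⟨x, hx, hx0⟩ : ∃ x ∈ LinearMap.ker (Phi (grid n)), x ≠ 0 := by
    apply Submodule.exists_mem_ne_zero_of_ne_bot
    intro h
    have : d n = 0 := by rw [d, nullity, h, finrank_bot]
    omega
  let X : Matrix (Fin n) (Fin n) (ZMod 2) := Matrix.of fun i j => x (i, j)
  have hX : InKernel X := (mem_ker_iff_inKernel X).1 hx
  have hX0 : X ≠ 0 := fun h => hx0 (by ext ⟨i, j⟩; exact congrFun (congrFun h i) j)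
  by_cases hA0 : pathMatrix n * X = 0
  · exact base X hX hX0 hA0
  by_cases hA1 : pathMatrix n * X = X
  · exact fixed X hX hX0 hA1
  have hAX := hX.pathMatrix_mul
  -- Now $X$ and $AX$ span the kernel, so $A^2X$ is one of four elements; each of the first three
  -- yields a nonzero vector killed or fixed by $A$.
  have cases := @InKernel.cases n hn _ _ (pathMatrix n * (pathMatrix n * X)) hX hAX hX0 hA0
    (Ne.symm hA1) hAX.pathMatrix_mul
  rcases cases with h | h | h | h
  · exact base _ hAX hA0 h
  · refine fixed _ (hX.add hAX) (fun e => hA1 (eq_of_add_eq_zero_of_zmod_two e).symm) ?_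
    rw [mul_add, h, add_comm]
  · exact fixed _ hAX hA0 h
  · have h5 := five_dvd_of_pathMatrix_quadratic hX0 h
    obtain ⟨Z, hZ, hne⟩ := exists_inKernel_not_quadratic h5
    refine absurd ?_ hne
    have h' := congrArg (pathMatrix n * ·) h
    simp only [mul_add] at h'
    rcases InKernel.cases hn hX hAX hX0 hA0 (Ne.symm hA1) hZ with rfl | rfl | rfl | rfl
    · simp
    · exact h
    · exact h'
    · simp only [mul_add]
      rw [h', h]

/-! ### Clicks and Hamming weights -/

/-- The number of vertices clicked in `x`. -/
def weight {V : Type*} [Fintype V] (x : V → ZMod 2) : ℕ := #{v | x v = 1}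

/-- The parity of the number of times each vertex is clicked in a sequence. -/
def parity {V : Type*} [DecidableEq V] (l : List V) (v : V) : ZMod 2 := l.count v

section Clicks

variable {V : Type*} [DecidableEq V]

theorem parity_cons (v : V) (l : List V) : parity (v :: l) = Pi.single v 1 + parity l := by
  ext w
  by_cases h : v = w
  · subst h
    simp [parity, add_comm]
  · simp [parity, h]

variable [Fintype V] (G : SimpleGraph V)

theorem Phi_single (v : V) : Phi G (Pi.single v 1) = toggle G v := by
  simp [Phi]

theorem foldl_click (l : List V) (c : V → ZMod 2) :
    l.foldl (click G) c = c + Phi G (parity l) := by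
  induction l generalizing c with
  | nil =>
    have : parity ([] : List V) = 0 := by
      ext
      simp [parity]
    simp [this]
  | cons v l ih => rw [List.foldl_cons, ih, parity_cons, map_add, Phi_single, click, add_assoc]

theorem isSolution_iff (c : V → ZMod 2) (l : List V) :
    IsSolution G c l ↔ Phi G (parity l) = c := by
  rw [IsSolution, foldl_click]
  constructor
  · exact fun h => (eq_of_add_eq_zero_of_zmod_two h).symm
  · rintro rfl
    exact add_self_eq_zero_of_zmod_two _

theorem weight_parity_le (l : List V) : weight (parity l) ≤ l.length := by
  refine le_trans (card_le_card fun v hv => ?_) l.toFinset_card_le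
  rw [List.mem_toFinset]
  by_contra h
  rw [mem_filter_univ, parity, List.count_eq_zero_of_not_mem h] at hv
  exact absurd hv (by decide)

theorem exists_list_parity_eq (x : V → ZMod 2) : ∃ l : List V, parity l = x ∧
    l.length = weight x := by
  refine ⟨(univ.filter fun v => x v = 1).toList, ?_, length_toList _⟩
  ext v
  have h : ∀ a : ZMod 2, a ≠ 1 → a = 0 := by decide
  by_cases hv : x v = 1
  · rw [parity, List.count_eq_one_of_mem (nodup_toList _) (by simpa using hv), hv, Nat.cast_one]
  · rw [parity, List.count_eq_zero_of_not_mem (by simpa using hv), h _ hv, Nat.cast_zero]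

/-- Solutions of a configuration have parities forming a coset of the kernel, and a parity vector is
realised most cheaply by clicking each vertex of its support once. -/
theorem requiresClicks_of_forall_weight {x : V → ZMod 2}
    (h : ∀ κ ∈ LinearMap.ker (Phi G), weight x ≤ weight (x + κ)) :
    RequiresClicks G (Phi G x) (weight x) := by
  constructor
  · obtain ⟨l, hl, hlen⟩ := exists_list_parity_eq x
    exact ⟨l, (isSolution_iff G _ _).2 (by rw [hl]), hlen⟩
  · rintro k ⟨l, hl, rfl⟩
    rw [isSolution_iff] at hl
    refine le_trans ?_ (weight_parity_le l)
    have := h (parity l - x) (by rw [LinearMap.mem_ker, map_sub, hl, sub_self])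
    rwa [add_sub_cancel] at this

theorem RequiresClicks.exists_forall_le_weight {c : V → ZMod 2} {m : ℕ}
    (h : RequiresClicks G c m) :
    ∃ x, ∀ κ ∈ LinearMap.ker (Phi G), m ≤ weight (x + κ) := by
  obtain ⟨⟨l, hl, -⟩, hmin⟩ := h
  rw [isSolution_iff] at hl
  refine ⟨parity l, fun κ hκ => ?_⟩
  obtain ⟨l', hl', hlen⟩ := exists_list_parity_eq (parity l + κ)
  exact hmin ⟨l', (isSolution_iff G _ _).2
    (by rw [hl', map_add, hl, LinearMap.mem_ker.1 hκ, add_zero]), hlen⟩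

end Clicks

/-! ### The covering radius of a plane of binary words -/

section Covering

variable {V : Type*}

theorem weight_eq_sum [Fintype V] (x : V → ZMod 2) : weight x = ∑ v, (x v).val := by
  have h : ∀ a : ZMod 2, (if a = 1 then 1 else 0) = a.val := by decide
  rw [weight, card_filter]
  exact sum_congr rfl fun v _ => h (x v)

/-- A vertex where $a$ or $b$ is nonzero lies in exactly two of the four supports; any other vertex
lies in all or none. -/
theorem sum_weights_le [Fintype V] (x a b : V → ZMod 2) :
    weight x + weight (x + a) + weight (x + b) + weight (x + (a + b)) ≤
      4 * #{v | a v = 0 ∧ b v = 0} + 2 * (#{v | a v = 1 ∧ b v = 1} + #{v | a v = 1 ∧ b v = 0} +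
        #{v | a v = 0 ∧ b v = 1}) := by
  have key : ∀ s p q : ZMod 2, s.val + (s + p).val + (s + q).val + (s + (p + q)).val ≤
      4 * (if p = 0 ∧ q = 0 then 1 else 0) + 2 * ((if p = 1 ∧ q = 1 then 1 else 0) +
        (if p = 1 ∧ q = 0 then 1 else 0) + (if p = 0 ∧ q = 1 then 1 else 0)) := by decide
  simp only [weight_eq_sum, card_filter, mul_sum, ← sum_add_distrib]
  exact sum_le_sum fun v _ => key (x v) (a v) (b v)

/-- Adding a constant either keeps `S` or replaces it by its complement in `C`, which has the same
size. -/
theorem card_filter_eq_one_of_half [DecidableEq V] {C S : Finset V} {x κ : V → ZMod 2} (ε : ZMod 2) (hS : S ⊆ C)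
    (hc : 2 * #S = #C) (hx : ∀ v ∈ C, x v = if v ∈ S then 1 else 0) (hκ : ∀ v ∈ C, κ v = ε) :
    2 * #{v ∈ C | (x + κ) v = 1} = #C := by
  have hε : ∀ e : ZMod 2, e = 0 ∨ e = 1 := by decide
  rcases hε ε with rfl | rfl
  · have : {v ∈ C | (x + κ) v = 1} = S := by
      ext v
      simp only [mem_filter, Pi.add_apply]
      constructor
      · rintro ⟨hv, h⟩
        by_contra hvS
        simp [hx v hv, hκ v hv, hvS] at h
      · intro hv
        simp [hS hv, hx v (hS hv), hκ v (hS hv), hv]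
    rw [this, hc]
  · have : {v ∈ C | (x + κ) v = 1} = C \ S := by
      ext v
      simp only [mem_filter, Pi.add_apply, mem_sdiff]
      refine and_congr_right fun hv => ?_
      rw [hx v hv, hκ v hv]
      by_cases hvS : v ∈ S <;> simp [hvS, show (1 : ZMod 2) + 1 = 0 from rfl]
    rw [this, card_sdiff_of_subset hS]
    omega

theorem weight_eq_sum_classes [Fintype V] (x a b : V → ZMod 2) :
    weight x = #{v ∈ {v | a v = 0 ∧ b v = 0} | x v = 1} + #{v ∈ {v | a v = 1 ∧ b v = 1} | x v = 1} +
      #{v ∈ {v | a v = 1 ∧ b v = 0} | x v = 1} + #{v ∈ {v | a v = 0 ∧ b v = 1} | x v = 1} := by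
  have key : ∀ s p q : ZMod 2, (if s = 1 then 1 else 0) =
      (if (p = 0 ∧ q = 0) ∧ s = 1 then 1 else 0) + (if (p = 1 ∧ q = 1) ∧ s = 1 then 1 else 0) +
        (if (p = 1 ∧ q = 0) ∧ s = 1 then 1 else 0) +
        (if (p = 0 ∧ q = 1) ∧ s = 1 then 1 else 0) := by decide
  simp only [weight, filter_filter, card_filter, ← sum_add_distrib]
  exact sum_congr rfl fun v _ => key (x v) (a v) (b v)

variable [Fintype V] [DecidableEq V]

theorem exists_forall_weight_eq {a b : V → ZMod 2} {M : ℕ}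
    (h11 : 2 ∣ #{v | a v = 1 ∧ b v = 1}) (h10 : 2 ∣ #{v | a v = 1 ∧ b v = 0})
    (h01 : 2 ∣ #{v | a v = 0 ∧ b v = 1})
    (hM : 2 * #{v | a v = 0 ∧ b v = 0} + (#{v | a v = 1 ∧ b v = 1} + #{v | a v = 1 ∧ b v = 0} +
        #{v | a v = 0 ∧ b v = 1}) = 2 * M) :
    ∃ x : V → ZMod 2, weight x = M ∧ weight (x + a) = M ∧ weight (x + b) = M ∧
      weight (x + (a + b)) = M := by
  obtain ⟨s11, h11⟩ := h11
  obtain ⟨s10, h10⟩ := h10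
  obtain ⟨s01, h01⟩ := h01
  obtain ⟨S11, hS11, c11⟩ := exists_subset_card_eq
    (show s11 ≤ #{v | a v = 1 ∧ b v = 1} by omega)
  obtain ⟨S10, hS10, c10⟩ := exists_subset_card_eq
    (show s10 ≤ #{v | a v = 1 ∧ b v = 0} by omega)
  obtain ⟨S01, hS01, c01⟩ := exists_subset_card_eq
    (show s01 ≤ #{v | a v = 0 ∧ b v = 1} by omega)
  -- Equality in the averaging bound requires ones wherever $a=b=0$; filling half of every other
  -- class makes all four weights equal.
  let x : V → ZMod 2 := fun v => if a v = 0 ∧ b v = 0 then 1 else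
    if a v = 1 ∧ b v = 1 then (if v ∈ S11 then 1 else 0) else
    if a v = 1 ∧ b v = 0 then (if v ∈ S10 then 1 else 0) else (if v ∈ S01 then 1 else 0)
  have main : ∀ p q : ZMod 2, weight (x + (p • a + q • b)) = M := by
    intro p q
    have e00 : #{v ∈ {v | a v = 0 ∧ b v = 0} | (x + (p • a + q • b)) v = 1} =
        #{v | a v = 0 ∧ b v = 0} := by
      congr 1
      refine filter_true_of_mem fun v hv => ?_
      simp only [mem_filter_univ] at hv
      simp [x, hv]
    have e11 := card_filter_eq_one_of_half (x := x) (κ := p • a + q • b) (p + q) hS11 (by omega)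
      (fun v hv => by simp only [mem_filter_univ] at hv; simp [x, hv])
      (fun v hv => by simp only [mem_filter_univ] at hv; simp [hv])
    have e10 := card_filter_eq_one_of_half (x := x) (κ := p • a + q • b) p hS10 (by omega)
      (fun v hv => by simp only [mem_filter_univ] at hv; simp [x, hv])
      (fun v hv => by simp only [mem_filter_univ] at hv; simp [hv])
    have e01 := card_filter_eq_one_of_half (x := x) (κ := p • a + q • b) q hS01 (by omega)
      (fun v hv => by simp only [mem_filter_univ] at hv; simp [x, hv])
      (fun v hv => by simp only [mem_filter_univ] at hv; simp [hv])
    have := weight_eq_sum_classes (x + (p • a + q • b)) a b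
    omega
  exact ⟨x, by simpa using main 0 0, by simpa using main 1 0, by simpa using main 0 1,
    by simpa using main 1 1⟩

theorem isMostClicks_of_ker_plane (G : SimpleGraph V) {a b : V → ZMod 2} {M : ℕ}
    (ha : a ∈ LinearMap.ker (Phi G)) (hb : b ∈ LinearMap.ker (Phi G))
    (hker : ∀ κ ∈ LinearMap.ker (Phi G), κ = 0 ∨ κ = a ∨ κ = b ∨ κ = a + b)
    (h11 : 2 ∣ #{v | a v = 1 ∧ b v = 1}) (h10 : 2 ∣ #{v | a v = 1 ∧ b v = 0})
    (h01 : 2 ∣ #{v | a v = 0 ∧ b v = 1})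
    (hM : 2 * #{v | a v = 0 ∧ b v = 0} + (#{v | a v = 1 ∧ b v = 1} + #{v | a v = 1 ∧ b v = 0} +
        #{v | a v = 0 ∧ b v = 1}) = 2 * M) : IsMostClicks G M := by
  constructor
  · obtain ⟨x, e, ea, eb, eab⟩ := exists_forall_weight_eq h11 h10 h01 hM
    refine ⟨Phi G x, ?_⟩
    have := requiresClicks_of_forall_weight G (x := x) fun κ hκ => by
      rcases hker κ hκ with rfl | rfl | rfl | rfl
      · simp
      · rw [e, ea]
      · rw [e, eb]
      · rw [e, eab]
    rwa [e] at this
  · rintro m ⟨c, hc⟩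
    obtain ⟨x, hx⟩ := hc.exists_forall_le_weight
    have h0 := hx 0 (Submodule.zero_mem _)
    have h1 := hx a ha
    have h2 := hx b hb
    have h3 := hx (a + b) (Submodule.add_mem _ ha hb)
    rw [add_zero] at h0
    have := sum_weights_le x a b
    omega

end Covering

/-! ### The grid of side `6 k - 1` -/

/-- The indicator of the odd positions, a kernel vector of the path matrix. -/
def stripe₂ (i : ℕ) : ZMod 2 := if i % 2 = 1 then 1 else 0

/-- The indicator of the positions not divisible by three, a fixed vector of the path matrix. -/
def stripe₃ (i : ℕ) : ZMod 2 := if i % 3 = 0 then 0 else 1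

theorem stripe₂_step (i : ℕ) : stripe₂ i + stripe₂ (i + 2) = 0 := by
  simp only [stripe₂, Nat.add_mod_right]
  exact add_self_eq_zero_of_zmod_two _

theorem stripe₃_step (i : ℕ) : stripe₃ (i + 1) + (stripe₃ i + stripe₃ (i + 2)) = 0 := by
  have h : i % 3 = 0 ∨ i % 3 = 1 ∨ i % 3 = 2 := by omega
  rcases h with h | h | h <;> simp [stripe₃, Nat.add_mod, h] <;> rfl

/-- For $X=uv^{T}$ with $Au=0$ and $Av=v$, one has $AX=0$ and $XA=X$, so the sum is $X+X=0$. -/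
theorem inKernel_stripes {n : ℕ} (hn : 6 ∣ n + 1) :
    InKernel (Matrix.of fun i j : Fin n => stripe₂ (i + 1) * stripe₃ (j + 1)) := by
  have h2 : (n + 1) % 2 = 0 := by omega
  have h3 : (n + 1) % 3 = 0 := by omega
  refine inKernel_of_sequence (fun i j => stripe₂ i * stripe₃ j) ?_ ?_ ?_ ?_ fun i j => ?_
  · simp [stripe₂]
  · simp [stripe₃]
  · simp [stripe₂, h2]
  · simp [stripe₃, h3]
  · rw [← add_mul, stripe₂_step, zero_mul, add_zero, ← mul_add, ← mul_add, stripe₃_step, mul_zero]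

theorem sum_stripes (k : ℕ) :
    ∑ i ∈ range (6 * k), (if stripe₂ (i + 1) = 1 then 1 else 0) = 3 * k ∧
    ∑ i ∈ range (6 * k), (if stripe₃ (i + 1) = 1 then 1 else 0) = 4 * k ∧
    ∑ i ∈ range (6 * k), (if stripe₂ (i + 1) = 1 ∧ stripe₃ (i + 1) = 1 then 1 else 0) = 2 * k := by
  induction k with
  | zero => simp
  | succ k ih =>
    obtain ⟨h1, h2, h3⟩ := ih
    have e2 : ∀ j, stripe₂ (6 * k + j) = stripe₂ j := fun j => by
      simp only [stripe₂, show (6 * k + j) % 2 = j % 2 by omega]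
    have e3 : ∀ j, stripe₃ (6 * k + j) = stripe₃ j := fun j => by
      simp only [stripe₃, show (6 * k + j) % 3 = j % 3 by omega]
    rw [show 6 * (k + 1) = 6 * k + 6 by ring]
    simp only [sum_range_add, h1, h2, h3, add_assoc, e2, e3]
    have c2 : ∑ i ∈ range 6, (if stripe₂ (i + 1) = 1 then 1 else 0) = 3 := by decide
    have c3 : ∑ i ∈ range 6, (if stripe₃ (i + 1) = 1 then 1 else 0) = 4 := by decide
    have c23 : ∑ i ∈ range 6, (if stripe₂ (i + 1) = 1 ∧ stripe₃ (i + 1) = 1 then 1 else 0) =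
        2 := by decide
    rw [c2, c3, c23]
    omega

/-- Adding the empty position $n+1=6k$ allows counting over whole periods of length 6. -/
theorem card_fin_eq_sum_range {n : ℕ} (p : ℕ → Prop) [DecidablePred p] (hp : ¬ p (n + 1)) :
    #{i : Fin n | p (i + 1)} = ∑ i ∈ range (n + 1), if p (i + 1) then 1 else 0 := by
  rw [card_filter, sum_range_succ, if_neg hp, add_zero,
    Fin.sum_univ_eq_sum_range (fun i => if p (i + 1) then 1 else 0) n]

theorem card_stripes {n k : ℕ} (hk : n + 1 = 6 * k) :
    #{i : Fin n | stripe₂ (i + 1) = 1} = 3 * k ∧ #{i : Fin n | stripe₃ (i + 1) = 1} = 4 * k ∧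
    #{i : Fin n | stripe₂ (i + 1) = 1 ∧ stripe₃ (i + 1) = 1} = 2 * k := by
  have h2 : stripe₂ (n + 1) = 0 := by
    simp only [stripe₂, show (n + 1) % 2 = 0 by omega]
    rfl
  have h3 : stripe₃ (n + 1) = 0 := by simp [stripe₃, show (n + 1) % 3 = 0 by omega]
  obtain ⟨e1, e2, e3⟩ := sum_stripes k
  rw [← hk] at e1 e2 e3
  refine ⟨?_, ?_, ?_⟩
  · rw [card_fin_eq_sum_range (fun i => stripe₂ i = 1) (by simp [h2]), e1]
  · rw [card_fin_eq_sum_range (fun i => stripe₃ i = 1) (by simp [h3]), e2]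
  · rw [card_fin_eq_sum_range (fun i => stripe₂ i = 1 ∧ stripe₃ i = 1) (by simp [h2]), e3]

theorem card_filter_prod_fin {n : ℕ} (p q : Fin n → Prop) [DecidablePred p] [DecidablePred q] :
    #{v : Fin n × Fin n | p v.1 ∧ q v.2} = #{i | p i} * #{i | q i} := by
  rw [← card_product]
  congr 1
  ext v
  simp

/-- The kernel element with rows along `stripe₂` and columns along `stripe₃`. -/
def κ₁ (n : ℕ) (v : Fin n × Fin n) : ZMod 2 := stripe₂ (v.1 + 1) * stripe₃ (v.2 + 1)

/-- The transpose of `κ₁`. -/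
def κ₂ (n : ℕ) (v : Fin n × Fin n) : ZMod 2 := stripe₂ (v.2 + 1) * stripe₃ (v.1 + 1)

theorem mul_eq_one_iff_zmod_two : ∀ a b : ZMod 2, a * b = 1 ↔ a = 1 ∧ b = 1 := by decide

theorem card_classes {n k : ℕ} (hk : n + 1 = 6 * k) :
    #{v | κ₁ n v = 1 ∧ κ₂ n v = 1} = 4 * k ^ 2 ∧ #{v | κ₁ n v = 1 ∧ κ₂ n v = 0} = 8 * k ^ 2 ∧
    #{v | κ₁ n v = 0 ∧ κ₂ n v = 1} = 8 * k ^ 2 ∧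
    #{v | κ₁ n v = 0 ∧ κ₂ n v = 0} + 20 * k ^ 2 = n ^ 2 := by
  obtain ⟨e2, e3, e23⟩ := card_stripes hk
  have f1 : #{v | κ₁ n v = 1} = 12 * k ^ 2 := by
    simp only [κ₁, mul_eq_one_iff_zmod_two]
    rw [card_filter_prod_fin (fun i : Fin n => stripe₂ (i + 1) = 1)
      (fun i : Fin n => stripe₃ (i + 1) = 1), e2, e3]
    ring
  have f2 : #{v | κ₂ n v = 1} = 12 * k ^ 2 := by
    simp only [κ₂, mul_eq_one_iff_zmod_two, and_comm (a := stripe₂ _ = 1)]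
    rw [card_filter_prod_fin (fun i : Fin n => stripe₃ (i + 1) = 1)
      (fun i : Fin n => stripe₂ (i + 1) = 1), e2, e3]
    ring
  have f12 : #{v | κ₁ n v = 1 ∧ κ₂ n v = 1} = 4 * k ^ 2 := by
    rw [show 4 * k ^ 2 = 2 * k * (2 * k) by ring, ← e23, ← card_filter_prod_fin]
    congr 1
    ext v
    simp only [κ₁, κ₂, mul_eq_one_iff_zmod_two, mem_filter_univ]
    tauto
  have g1 : #{v | κ₁ n v = 1} =
      #{v | κ₁ n v = 1 ∧ κ₂ n v = 1} + #{v | κ₁ n v = 1 ∧ κ₂ n v = 0} := by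
    have key : ∀ p q : ZMod 2, (if p = 1 then 1 else 0) =
        (if p = 1 ∧ q = 1 then 1 else 0) + (if p = 1 ∧ q = 0 then 1 else 0) := by decide
    simp only [card_filter, ← sum_add_distrib]
    exact sum_congr rfl fun v _ => key _ _
  have g2 : #{v | κ₂ n v = 1} =
      #{v | κ₁ n v = 1 ∧ κ₂ n v = 1} + #{v | κ₁ n v = 0 ∧ κ₂ n v = 1} := by
    have key : ∀ p q : ZMod 2, (if q = 1 then 1 else 0) =
        (if p = 1 ∧ q = 1 then 1 else 0) + (if p = 0 ∧ q = 1 then 1 else 0) := by decide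
    simp only [card_filter, ← sum_add_distrib]
    exact sum_congr rfl fun v _ => key _ _
  have g : n ^ 2 = #{v | κ₁ n v = 1 ∧ κ₂ n v = 1} + #{v | κ₁ n v = 1 ∧ κ₂ n v = 0} +
      #{v | κ₁ n v = 0 ∧ κ₂ n v = 1} + #{v | κ₁ n v = 0 ∧ κ₂ n v = 0} := by
    have key : ∀ p q : ZMod 2, 1 = (if p = 1 ∧ q = 1 then 1 else 0) +
        (if p = 1 ∧ q = 0 then 1 else 0) + (if p = 0 ∧ q = 1 then 1 else 0) +
        (if p = 0 ∧ q = 0 then 1 else 0) := by decide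
    have hc : n ^ 2 = ∑ _v : Fin n × Fin n, 1 := by simp [sq]
    simp only [hc, card_filter, ← sum_add_distrib]
    exact sum_congr rfl fun v _ => key _ _
  omega

theorem isMostClicks_grid {n k m : ℕ} (hd : d n = 2) (hk : n + 1 = 6 * k)
    (hm : m + 12 * k = 26 * k ^ 2 + 1) : IsMostClicks (grid n) m := by
  have h6 : 6 ∣ n + 1 := ⟨k, hk⟩
  have h5 : 5 ≤ n := by omega
  have hK := inKernel_stripes h6
  have h₁ : κ₁ n ∈ LinearMap.ker (Phi (grid n)) :=
    (mem_ker_iff_inKernel (Matrix.of fun i j => κ₁ n (i, j))).2 hK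
  have h₂ : κ₂ n ∈ LinearMap.ker (Phi (grid n)) :=
    (mem_ker_iff_inKernel (Matrix.of fun i j => κ₂ n (i, j))).2 hK.transpose
  -- The vertex at positions $(1,2)$ and its mirror image separate the two elements, since 1 is odd,
  -- 2 is even and neither is divisible by 3.
  have v₁ : κ₁ n (⟨0, by omega⟩, ⟨1, by omega⟩) = 1 := by simp [κ₁, stripe₂, stripe₃]
  have v₂ : κ₂ n (⟨0, by omega⟩, ⟨1, by omega⟩) = 0 := by simp [κ₂, stripe₂]
  have w₂ : κ₂ n (⟨1, by omega⟩, ⟨0, by omega⟩) = 1 := by simp [κ₂, stripe₂, stripe₃]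
  have n₁ : κ₁ n ≠ 0 := fun h => by simp [h] at v₁
  have n₂ : κ₂ n ≠ 0 := fun h => by simp [h] at w₂
  have n₁₂ : κ₁ n ≠ κ₂ n := fun h => by simp [h, v₂] at v₁
  obtain ⟨c11, c10, c01, c00⟩ := card_classes hk
  refine isMostClicks_of_ker_plane (grid n) h₁ h₂
    (fun κ hκ => mem_plane_cases hd h₁ h₂ n₁ n₂ n₁₂ hκ) (by omega) (by omega) (by omega) ?_
  -- The class $(0,0)$ thus has $16k^2-12k+1$ vertices; half of the remaining $20k^2$ brings the
  -- total to $26k^2-12k+1$.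
  have : n ^ 2 + 12 * k = 36 * k ^ 2 + 1 := by
    obtain rfl : n = 6 * k - 1 := by omega
    obtain ⟨k, rfl⟩ := Nat.exists_eq_add_of_le' (show 1 ≤ k by omega)
    rw [show 6 * (k + 1) - 1 = 6 * k + 5 by omega]
    ring
  omega

end LightsOut

theorem theorem4 (n : ℕ) (hn : LightsOut.d n = 2) :
    (n : ℤ) ≡ -1 [ZMOD 6] ∧
      ∃ k m : ℕ, (n : ℤ) = 6 * (k : ℤ) - 1 ∧
        (m : ℤ) = 26 * (k : ℤ) ^ 2 - 12 * (k : ℤ) + 1 ∧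
        LightsOut.IsMostClicks (LightsOut.grid n) m := by
  obtain ⟨k, hk⟩ := LightsOut.six_dvd_of_d_eq_two hn
  have hle : 12 * k ≤ 26 * k ^ 2 + 1 := by nlinarith [Nat.le_self_pow two_ne_zero k]
  obtain ⟨m, hm⟩ := Nat.exists_eq_add_of_le' hle
  refine ⟨?_, k, m, by omega, ?_, LightsOut.isMostClicks_grid hn hk hm.symm⟩
  · rw [Int.modEq_iff_dvd]
    omega
  · have : (26 * k ^ 2 + 1 : ℤ) = m + 12 * k := by exact_mod_cast hm
    linarith
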